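/- Let $\mathfrak S_n^B$ be the group of signed permutations of length $n$, i.e. the permutations $\sigma$ of $\{-n,\ldots,-1,1,\ldots,n\}$ with $\sigma(-i)=-\sigma(i)$ for all $i$, and write $\sigma_i=\sigma(i)$ for $1\le i\le n$. A fixed point of $\sigma$ is an integer $i$ with $1\le i\le n$ and $\sigma(i)=i$; a derangement of type $B$ is a $\sigma\in\mathfrak S_n^B$ without fixed points. A signed permutation $\sigma\in\mathfrak S_n^B$ ($n\ge1$) is of type - $-DU$ if $0>\sigma_1>\sigma_2<\sigma_3>\cdots$, - $-UD$ if $0>\sigma_1<\sigma_2>\sigma_3<\cdots$, - $+DU$ if $0<\sigma_1>\sigma_2<\sigma_3>\cdots$, - $+UD$ if $0<\sigma_1<\sigma_2>\sigma_3<\cdots$, each chain of alternating inequalities ending at $\sigma_n$. For each of these types $*$, let $d_k^{*}(n)$ be the number of $\sigma\in\mathfrak S_n^B$ of type $*$ with exactly $k$ fixed points. Let $D_m^B$ be the number of derangements of type $B$ in $\mathfrak S_m^B$ (so $D_0^B=1$); for $m\ge1$, let $D_m^-$ be the number of those with $\sigma(1)<0$, and $D_m^{-D}$ the number of those with $0>\sigma(1)>\sigma(2)$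 (for $m=1$, where $\sigma(2)$ does not exist, this condition reads $0>\sigma(1)$). **Theorem.** For every $n\ge 1$, $$d^{-DU}_{\lceil (n-2)/2\rceil}(n)=D^{-D}_{\lfloor (n+2)/2\rfloor},\qquad d^{-UD}_{\lceil (n-1)/2\rceil}(n)=D^{-}_{\lfloor (n+1)/2\rfloor},$$ $$d^{+DU}_{\lceil n/2\rceil}(n)=D^{B}_{\lfloor n/2\rfloor},\qquad d^{+UD}_{\lceil (n+1)/2\rceil}(n)=D^{B}_{\lfloor (n-1)/2\rfloor}.$$ -/

import Mathlib

/-- The set `[±n] = {-n, …, -1, 1, …, n}`. -/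
abbrev PlusMinus (n : ℕ) : Type := {i : ℤ // i ≠ 0 ∧ |i| ≤ (n : ℤ)}

instance PlusMinus.instNeg (n : ℕ) : Neg (PlusMinus n) :=
  ⟨fun i => ⟨-i.1, neg_ne_zero.mpr i.2.1, (abs_neg i.1).trans_le i.2.2⟩⟩

/-- Signed permutations of length `n`: the permutations `σ` of `[±n]` with `σ (-i) = -σ i`. -/
abbrev SignedPerm (n : ℕ) : Type :=
  {σ : Equiv.Perm (PlusMinus n) // ∀ i : PlusMinus n, σ (-i) = -σ i}

namespace SignedPerm

/-- The entry `σ(i) = σ_i` as an integer. It is only ever used for `1 ≤ i ≤ n`;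
outside `[±n]` it is given the value `0`. -/
def entry {n : ℕ} (σ : SignedPerm n) (i : ℤ) : ℤ :=
  if h : i ≠ 0 ∧ |i| ≤ (n : ℤ) then (σ.1 ⟨i, h⟩).1 else 0

/-- The number of fixed points, i.e. of positive integers `i ≤ n` with `σ(i) = i`. -/
def numFixed {n : ℕ} (σ : SignedPerm n) : ℕ :=
  ((Finset.Icc 1 n).filter fun i : ℕ => σ.entry i = i).card

/-- `σ_1 > σ_2 < σ_3 > σ_4 < ⋯`. -/
def DownUp {n : ℕ} (σ : SignedPerm n) : Prop :=
  ∀ i : ℕ, 1 ≤ i → i + 1 ≤ n →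
    (Odd i → σ.entry (i + 1) < σ.entry i) ∧ (Even i → σ.entry i < σ.entry (i + 1))

/-- `σ_1 < σ_2 > σ_3 < σ_4 > ⋯`. -/
def UpDown {n : ℕ} (σ : SignedPerm n) : Prop :=
  ∀ i : ℕ, 1 ≤ i → i + 1 ≤ n →
    (Odd i → σ.entry i < σ.entry (i + 1)) ∧ (Even i → σ.entry (i + 1) < σ.entry i)

/-- Type `-DU`: `0 > σ_1 > σ_2 < σ_3 > ⋯`. -/
def IsNegDU {n : ℕ} (σ : SignedPerm n) : Prop := σ.entry 1 < 0 ∧ σ.DownUp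

/-- Type `-UD`: `0 > σ_1 < σ_2 > σ_3 < ⋯`. -/
def IsNegUD {n : ℕ} (σ : SignedPerm n) : Prop := σ.entry 1 < 0 ∧ σ.UpDown

/-- Type `+DU`: `0 < σ_1 > σ_2 < σ_3 > ⋯`. -/
def IsPosDU {n : ℕ} (σ : SignedPerm n) : Prop := 0 < σ.entry 1 ∧ σ.DownUp

/-- Type `+UD`: `0 < σ_1 < σ_2 > σ_3 < ⋯`. -/
def IsPosUD {n : ℕ} (σ : SignedPerm n) : Prop := 0 < σ.entry 1 ∧ σ.UpDown

/-- A derangement of type `B`: no positive `i ≤ n` has `σ(i) = i`. -/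
def IsDerangement {n : ℕ} (σ : SignedPerm n) : Prop :=
  ∀ i : ℕ, 1 ≤ i → i ≤ n → σ.entry i ≠ i

end SignedPerm

/-- The number of signed permutations of length `n` and type `-DU` with `k` fixed points. -/
noncomputable def dNegDU (k : ℤ) (n : ℕ) : ℕ :=
  Nat.card {σ : SignedPerm n // σ.IsNegDU ∧ (σ.numFixed : ℤ) = k}

/-- The number of signed permutations of length `n` and type `-UD` with `k` fixed points. -/
noncomputable def dNegUD (k : ℤ) (n : ℕ) : ℕ :=
  Nat.card {σ : SignedPerm n // σ.IsNegUD ∧ (σ.numFixed : ℤ) = k}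

/-- The number of signed permutations of length `n` and type `+DU` with `k` fixed points. -/
noncomputable def dPosDU (k : ℤ) (n : ℕ) : ℕ :=
  Nat.card {σ : SignedPerm n // σ.IsPosDU ∧ (σ.numFixed : ℤ) = k}

/-- The number of signed permutations of length `n` and type `+UD` with `k` fixed points. -/
noncomputable def dPosUD (k : ℤ) (n : ℕ) : ℕ :=
  Nat.card {σ : SignedPerm n // σ.IsPosUD ∧ (σ.numFixed : ℤ) = k}

/-- `D_n^B`: the number of derangements of type `B` of length `n`. -/
noncomputable def derangementsB (n : ℕ) : ℕ :=
  Nat.card {σ : SignedPerm n // σ.IsDerangement}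

/-- `D_n^-`: the number of derangements of type `B` with `σ(1) < 0`. -/
noncomputable def derangementsNeg (n : ℕ) : ℕ :=
  Nat.card {σ : SignedPerm n // σ.IsDerangement ∧ σ.entry 1 < 0}

/-- `D_n^{-D}`: the number of derangements of type `B` with `0 > σ(1) > σ(2)`, where the
chain stops at its last existing entry (so for `n = 1` it reads `0 > σ(1)`), as in the
definitions of the alternating types. -/
noncomputable def derangementsNegD (n : ℕ) : ℕ :=
  Nat.card {σ : SignedPerm n //
    σ.IsDerangement ∧ σ.entry 1 < 0 ∧ (2 ≤ n → σ.entry 2 < σ.entry 1)}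

namespace SignedPerm

variable {m n : ℕ}

/-! ### Entries of signed permutations -/

/-! At a descent `σ_i > σ_{i+1}` the points `i` and `i + 1` cannot both be fixed, and a negative
entry is never fixed. Cut the positions into `m` blocks: the `r` initial negative entries as
singletons (`r = 2` for `-DU`, where `σ_2 < σ_1 < 0`, `r = 1` for `-UD`, `r = 0` otherwise), then
the descents as pairs. For `+UD` the first position stays outside (`s = 1`), and by parity a last
position may remain (`e = 1`). Each block has a nonfixed point, so with `n - m` fixed points it has
exactly one, and every position outside the blocks is fixed.

Deleting the fixed points and standardizing gives a derangement `τ` of length `m`. Nothing is lost: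
in a pair whose upper end is fixed, the descent makes the lower end an excedance, and in a pair
whose lower end is fixed, the upper entry is smaller than its position. Standardization preserves
these comparisons, so `τ` tells which end of each block is occupied (`blockPos`).

Conversely, any derangement inflated in this way alternates on the pairs: descents within pairs hold
by the choice of ends, and between consecutive blocks `σ_j ≤ j < j + 1 ≤ σ_{j+1}`. Only the
conditions on the first `r` entries must be carried over to `τ`. The bijection is
`card_derangement_eq_card_blockwise`; `Alternating.isBlockwise` and `IsBlockwise.alternating`
identify its image, and `card_derangement_eq_card_alternating` covers all types except `-DU` of
length 1. -/

theorem entry_eq (σ : SignedPerm n) (x : PlusMinus n) : σ.entry x.1 = (σ.1 x).1 :=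
  dif_pos x.2

theorem natAbs_entry_pos (σ : SignedPerm n) {i : ℕ} (h1 : 1 ≤ i) (h2 : i ≤ n) :
    1 ≤ (σ.entry i).natAbs := by
  have h : (i : ℤ) ≠ 0 ∧ |(i : ℤ)| ≤ n := by rw [Nat.abs_cast]; omega
  have := (σ.1 ⟨i, h⟩).2.1
  rw [entry_eq σ ⟨i, h⟩]
  omega

theorem natAbs_entry_le (σ : SignedPerm n) {i : ℕ} (h1 : 1 ≤ i) (h2 : i ≤ n) :
    (σ.entry i).natAbs ≤ n := by
  have h : (i : ℤ) ≠ 0 ∧ |(i : ℤ)| ≤ n := by rw [Nat.abs_cast]; omega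
  have := (σ.1 ⟨i, h⟩).2.2
  rw [Int.abs_eq_natAbs] at this
  rw [entry_eq σ ⟨i, h⟩]
  omega

theorem natAbs_entry_injective (σ : SignedPerm n) {i j : ℕ} (hi1 : 1 ≤ i) (hi2 : i ≤ n)
    (hj1 : 1 ≤ j) (hj2 : j ≤ n) (h : (σ.entry i).natAbs = (σ.entry j).natAbs) : i = j := by
  have hi : (i : ℤ) ≠ 0 ∧ |(i : ℤ)| ≤ n := by rw [Nat.abs_cast]; omega
  have hj : (j : ℤ) ≠ 0 ∧ |(j : ℤ)| ≤ n := by rw [Nat.abs_cast]; omega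
  rw [entry_eq σ ⟨i, hi⟩, entry_eq σ ⟨j, hj⟩, Int.natAbs_eq_natAbs_iff] at h
  rcases h with h | h
  · have := congrArg Subtype.val (σ.1.injective (Subtype.ext h))
    simpa using this
  · have h' : σ.1 ⟨i, hi⟩ = σ.1 (-⟨j, hj⟩) := by
      rw [σ.2]; exact Subtype.ext h
    have : (i : ℤ) = -(j : ℤ) := congrArg Subtype.val (σ.1.injective h')
    omega

theorem ext_entry {σ τ : SignedPerm n} (h : ∀ i : ℕ, 1 ≤ i → i ≤ n → σ.entry i = τ.entry i) :
    σ = τ := by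
  have key : ∀ (x : PlusMinus n), 0 < x.1 → σ.1 x = τ.1 x := by
    intro x hx
    have hx2 := x.2.2
    have h' := h x.1.natAbs (by omega) (by rw [abs_of_pos hx] at hx2; omega)
    rw [Int.natAbs_of_nonneg hx.le, entry_eq, entry_eq] at h'
    exact Subtype.ext h'
  refine Subtype.ext (Equiv.ext fun x => ?_)
  rcases lt_or_gt_of_ne x.2.1 with hx | hx
  · have h1 := key (-x) (neg_pos.mpr hx)
    rw [σ.2, τ.2] at h1
    have h2 : -(σ.1 x).1 = -(τ.1 x).1 := congrArg Subtype.val h1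
    exact Subtype.ext (neg_inj.mp h2)
  · exact key x hx

/-- A window of nonzero integers with distinct absolute values extends to a signed permutation. -/
theorem exists_entry_eq (f : ℕ → ℤ) (h1 : ∀ i, 1 ≤ i → i ≤ n → 1 ≤ (f i).natAbs ∧ (f i).natAbs ≤ n)
    (h2 : ∀ i j, 1 ≤ i → i ≤ n → 1 ≤ j → j ≤ n → (f i).natAbs = (f j).natAbs → i = j) :
    ∃ σ : SignedPerm n, ∀ i : ℕ, 1 ≤ i → i ≤ n → σ.entry i = f i := by
  have hr : ∀ x : PlusMinus n, 1 ≤ x.1.natAbs ∧ x.1.natAbs ≤ n := fun x => by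
    have h := x.2
    rw [Int.abs_eq_natAbs] at h
    omega
  let g : PlusMinus n → PlusMinus n := fun x => ⟨x.1.sign * f x.1.natAbs, by
    have h := h1 _ (hr x).1 (hr x).2
    have hx := x.2.1
    rw [Int.abs_eq_natAbs]
    rcases lt_or_gt_of_ne hx with hx | hx
    · rw [Int.sign_eq_neg_one_of_neg hx]; omega
    · rw [Int.sign_eq_one_of_pos hx]; omega⟩
  have hginj : Function.Injective g := by
    intro x y hxy
    have h : x.1.sign * f x.1.natAbs = y.1.sign * f y.1.natAbs := congrArg Subtype.val hxy
    have hx := h1 _ (hr x).1 (hr x).2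
    have habs : (f x.1.natAbs).natAbs = (f y.1.natAbs).natAbs := by
      have := congrArg Int.natAbs h
      rwa [Int.natAbs_mul, Int.natAbs_mul, Int.natAbs_sign_of_ne_zero x.2.1,
        Int.natAbs_sign_of_ne_zero y.2.1, one_mul, one_mul] at this
    have hxy' := h2 _ _ (hr x).1 (hr x).2 (hr y).1 (hr y).2 habs
    rw [← hxy'] at h
    have hs := mul_right_cancel₀ (b := f x.1.natAbs) (by omega) h
    refine Subtype.ext ?_
    rw [← Int.sign_mul_natAbs x.1, ← Int.sign_mul_natAbs y.1, hs, hxy']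
  have : Finite (PlusMinus n) := by
    refine Set.Finite.subset (Set.finite_Icc (-(n : ℤ)) n) fun i hi => ?_
    exact Set.mem_Icc.mpr (abs_le.mp hi.2)
  refine ⟨⟨Equiv.ofBijective g (Finite.injective_iff_bijective.mp hginj), fun x => ?_⟩,
    fun i hi1 hi2 => ?_⟩
  · refine Subtype.ext ?_
    change (-x.1).sign * f (-x.1).natAbs = -(x.1.sign * f x.1.natAbs)
    rw [Int.sign_neg, Int.natAbs_neg, neg_mul]
  · have h : (i : ℤ) ≠ 0 ∧ |(i : ℤ)| ≤ n := by rw [Nat.abs_cast]; omega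
    rw [entry_eq _ ⟨i, h⟩]
    change (i : ℤ).sign * f (i : ℤ).natAbs = f i
    rw [Int.sign_eq_one_of_pos (by omega), one_mul, Int.natAbs_natCast]

/-! ### Odd extensions -/

/-- The odd extension of `p` to the integers. -/
def oddExt (p : ℕ → ℕ) (z : ℤ) : ℤ := z.sign * p z.natAbs

theorem oddExt_of_pos (p : ℕ → ℕ) {z : ℤ} (hz : 0 < z) : oddExt p z = p z.natAbs := by
  rw [oddExt, Int.sign_eq_one_of_pos hz, one_mul]

theorem oddExt_of_neg (p : ℕ → ℕ) {z : ℤ} (hz : z < 0) : oddExt p z = -p z.natAbs := by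
  rw [oddExt, Int.sign_eq_neg_one_of_neg hz, neg_one_mul]

theorem natAbs_oddExt (p : ℕ → ℕ) {z : ℤ} (hz : z ≠ 0) : (oddExt p z).natAbs = p z.natAbs := by
  rcases lt_or_gt_of_ne hz with h | h
  · rw [oddExt_of_neg p h]; omega
  · rw [oddExt_of_pos p h]; omega

/-- `p` maps `{1, …, m}` into `{1, …, n}` and is strictly increasing there. -/
structure IsIncreasing (m n : ℕ) (p : ℕ → ℕ) : Prop where
  pos : ∀ i, 1 ≤ i → i ≤ m → 1 ≤ p i
  le : ∀ i, 1 ≤ i → i ≤ m → p i ≤ n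
  lt : ∀ i j, 1 ≤ i → i < j → j ≤ m → p i < p j

namespace IsIncreasing

variable {p : ℕ → ℕ}

theorem injective (hp : IsIncreasing m n p) {i j : ℕ} (hi1 : 1 ≤ i) (hi2 : i ≤ m) (hj1 : 1 ≤ j)
    (hj2 : j ≤ m) (h : p i = p j) : i = j := by
  rcases lt_trichotomy i j with h' | h' | h'
  · have := hp.lt i j hi1 h' hj2; omega
  · exact h'
  · have := hp.lt j i hj1 h' hi2; omega

/-- Oddness carries monotonicity to the negatives, and positivity of `p` separates the two signs.
Hence inflation preserves every comparison of entries. -/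
theorem oddExt_lt (hp : IsIncreasing m n p) {z w : ℤ} (hz : z ≠ 0) (hw : w ≠ 0)
    (hz' : z.natAbs ≤ m) (hw' : w.natAbs ≤ m) (h : z < w) : oddExt p z < oddExt p w := by
  have hz1 := hp.pos z.natAbs (by omega) hz'
  have hw1 := hp.pos w.natAbs (by omega) hw'
  rcases lt_or_gt_of_ne hz with h1 | h1 <;> rcases lt_or_gt_of_ne hw with h2 | h2
  · have := hp.lt w.natAbs z.natAbs (by omega) (by omega) hz'
    rw [oddExt_of_neg p h1, oddExt_of_neg p h2]; omega
  · rw [oddExt_of_neg p h1, oddExt_of_pos p h2]; omega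
  · omega
  · have := hp.lt z.natAbs w.natAbs (by omega) (by omega) hw'
    rw [oddExt_of_pos p h1, oddExt_of_pos p h2]; omega

theorem oddExt_lt_iff (hp : IsIncreasing m n p) {z w : ℤ} (hz : z ≠ 0) (hw : w ≠ 0)
    (hz' : z.natAbs ≤ m) (hw' : w.natAbs ≤ m) : oddExt p z < oddExt p w ↔ z < w := by
  refine ⟨fun h => ?_, hp.oddExt_lt hz hw hz' hw'⟩
  by_contra h'
  rcases (not_lt.mp h').lt_or_eq with h1 | h1
  · exact lt_asymm h (hp.oddExt_lt hw hz hw' hz' h1)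
  · rw [h1] at h; exact lt_irrefl _ h

end IsIncreasing

/-! ### Inserting fixed points -/

/-- `σ` arises from `τ` by moving position `i` to position `p i` (and values accordingly), and
inserting fixed points at all other positions. -/
structure IsInflation (p : ℕ → ℕ) (τ : SignedPerm m) (σ : SignedPerm n) : Prop where
  entry_apply : ∀ i : ℕ, 1 ≤ i → i ≤ m → σ.entry (p i) = oddExt p (τ.entry i)
  entry_of_ne : ∀ j : ℕ, 1 ≤ j → j ≤ n → (∀ i, 1 ≤ i → i ≤ m → p i ≠ j) → σ.entry j = j

namespace IsInflation

variable {p q : ℕ → ℕ} {τ τ' : SignedPerm m} {σ σ' : SignedPerm n}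

theorem congr (h : IsInflation p τ σ) (hpq : ∀ i, 1 ≤ i → i ≤ m → p i = q i) :
    IsInflation q τ σ := by
  refine ⟨fun i h1 h2 => ?_, fun j h1 h2 h3 => ?_⟩
  · rw [← hpq i h1 h2, h.entry_apply i h1 h2, oddExt, oddExt,
      hpq _ (τ.natAbs_entry_pos h1 h2) (τ.natAbs_entry_le h1 h2)]
  · exact h.entry_of_ne j h1 h2 fun i hi1 hi2 => by rw [hpq i hi1 hi2]; exact h3 i hi1 hi2

theorem unique_right (h : IsInflation p τ σ) (h' : IsInflation p τ σ') : σ = σ' := by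
  refine ext_entry fun j h1 h2 => ?_
  by_cases hj : ∃ i, 1 ≤ i ∧ i ≤ m ∧ p i = j
  · obtain ⟨i, hi1, hi2, rfl⟩ := hj
    rw [h.entry_apply i hi1 hi2, h'.entry_apply i hi1 hi2]
  · have hj' : ∀ i, 1 ≤ i → i ≤ m → p i ≠ j := fun i hi1 hi2 hi3 => hj ⟨i, hi1, hi2, hi3⟩
    rw [h.entry_of_ne j h1 h2 hj', h'.entry_of_ne j h1 h2 hj']

theorem unique_left (hp : IsIncreasing m n p) (h : IsInflation p τ σ) (h' : IsInflation p τ' σ) :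
    τ = τ' := by
  refine ext_entry fun i h1 h2 => ?_
  have e := (h.entry_apply i h1 h2).symm.trans (h'.entry_apply i h1 h2)
  have a1 := τ.natAbs_entry_pos h1 h2
  have a2 := τ.natAbs_entry_le h1 h2
  have b1 := τ'.natAbs_entry_pos h1 h2
  have b2 := τ'.natAbs_entry_le h1 h2
  rcases lt_trichotomy (τ.entry i) (τ'.entry i) with hlt | heq | hlt
  · have := hp.oddExt_lt (by omega) (by omega) a2 b2 hlt
    omega
  · exact heq
  · have := hp.oddExt_lt (by omega) (by omega) b2 a2 hlt
    omega

theorem entry_lt_iff (hp : IsIncreasing m n p) (h : IsInflation p τ σ) {i j : ℕ} (hi1 : 1 ≤ i)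
    (hi2 : i ≤ m) (hj1 : 1 ≤ j) (hj2 : j ≤ m) :
    σ.entry (p i) < σ.entry (p j) ↔ τ.entry i < τ.entry j := by
  have a1 := τ.natAbs_entry_pos hi1 hi2
  have b1 := τ.natAbs_entry_pos hj1 hj2
  rw [h.entry_apply i hi1 hi2, h.entry_apply j hj1 hj2]
  exact hp.oddExt_lt_iff (by omega) (by omega) (τ.natAbs_entry_le hi1 hi2)
    (τ.natAbs_entry_le hj1 hj2)

/-- The position `p i` is itself the value of `oddExt p` at `i`, so comparing an entry with its
position is again a comparison of two values of one increasing map. -/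
theorem lt_entry_iff (hp : IsIncreasing m n p) (h : IsInflation p τ σ) {i : ℕ} (hi1 : 1 ≤ i)
    (hi2 : i ≤ m) : (p i : ℤ) < σ.entry (p i) ↔ (i : ℤ) < τ.entry i := by
  have a1 := τ.natAbs_entry_pos hi1 hi2
  have e : (p i : ℤ) = oddExt p i := by
    rw [oddExt_of_pos p (by omega), Int.natAbs_natCast]
  rw [h.entry_apply i hi1 hi2, e]
  exact hp.oddExt_lt_iff (by omega) (by omega) (by omega) (τ.natAbs_entry_le hi1 hi2)

theorem entry_lt_self_iff (hp : IsIncreasing m n p) (h : IsInflation p τ σ) {i : ℕ} (hi1 : 1 ≤ i)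
    (hi2 : i ≤ m) : σ.entry (p i) < p i ↔ τ.entry i < i := by
  have a1 := τ.natAbs_entry_pos hi1 hi2
  have e : (p i : ℤ) = oddExt p i := by
    rw [oddExt_of_pos p (by omega), Int.natAbs_natCast]
  rw [h.entry_apply i hi1 hi2, e]
  exact hp.oddExt_lt_iff (by omega) (by omega) (τ.natAbs_entry_le hi1 hi2) (by omega)

theorem entry_neg_iff (hp : IsIncreasing m n p) (h : IsInflation p τ σ) {i : ℕ} (hi1 : 1 ≤ i)
    (hi2 : i ≤ m) : σ.entry (p i) < 0 ↔ τ.entry i < 0 := by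
  have a1 := τ.natAbs_entry_pos hi1 hi2
  have a2 := hp.pos _ a1 (τ.natAbs_entry_le hi1 hi2)
  rw [h.entry_apply i hi1 hi2]
  rcases lt_or_gt_of_ne (a := τ.entry i) (b := 0) (by omega) with h' | h'
  · rw [oddExt_of_neg p h']; omega
  · rw [oddExt_of_pos p h']; omega

end IsInflation

/-- On the image of `p` the absolute values are permuted as `τ` permutes them; off the image they
stay put. The two parts cannot collide. -/
theorem exists_isInflation {p : ℕ → ℕ} (hp : IsIncreasing m n p) (τ : SignedPerm m) :
    ∃ σ : SignedPerm n, IsInflation p τ σ := by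
  classical
  have hf : ∀ j : ℕ, ∃ z : ℤ, (∀ i, 1 ≤ i → i ≤ m → p i = j → z = oddExt p (τ.entry i)) ∧
      ((∀ i, 1 ≤ i → i ≤ m → p i ≠ j) → z = j) := by
    intro j
    by_cases hj : ∃ i, 1 ≤ i ∧ i ≤ m ∧ p i = j
    · obtain ⟨i, h1, h2, rfl⟩ := hj
      refine ⟨oddExt p (τ.entry i), fun k hk1 hk2 hk => ?_, fun h => absurd rfl (h i h1 h2)⟩
      rw [hp.injective hk1 hk2 h1 h2 hk]
    · exact ⟨j, fun i h1 h2 h => absurd ⟨i, h1, h2, h⟩ hj, fun _ => rfl⟩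
  choose f hf1 hf2 using hf
  have hcase : ∀ j, (∃ i, 1 ≤ i ∧ i ≤ m ∧ p i = j ∧ (f j).natAbs = p (τ.entry i).natAbs) ∨
      ((∀ i, 1 ≤ i → i ≤ m → p i ≠ j) ∧ f j = j) := by
    intro j
    by_cases hj : ∃ i, 1 ≤ i ∧ i ≤ m ∧ p i = j
    · obtain ⟨i, h1, h2, rfl⟩ := hj
      have := τ.natAbs_entry_pos h1 h2
      exact Or.inl ⟨i, h1, h2, rfl, by rw [hf1 _ i h1 h2 rfl, natAbs_oddExt p (by omega)]⟩
    · have hj' : ∀ i, 1 ≤ i → i ≤ m → p i ≠ j := fun i h1 h2 h => hj ⟨i, h1, h2, h⟩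
      exact Or.inr ⟨hj', hf2 j hj'⟩
  obtain ⟨σ, hσ⟩ := exists_entry_eq (n := n) f (fun j h1 h2 => by
      rcases hcase j with ⟨i, hi1, hi2, -, h⟩ | ⟨-, h⟩
      · have a1 := τ.natAbs_entry_pos hi1 hi2
        have a2 := τ.natAbs_entry_le hi1 hi2
        have := hp.pos _ a1 a2
        have := hp.le _ a1 a2
        omega
      · omega)
    (fun j k hj1 hj2 hk1 hk2 hjk => by
      rcases hcase j with ⟨i, hi1, hi2, hi, h⟩ | ⟨hi, h⟩ <;>
      rcases hcase k with ⟨l, hl1, hl2, hl, h'⟩ | ⟨hl, h'⟩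
      · have e := hp.injective (τ.natAbs_entry_pos hi1 hi2) (τ.natAbs_entry_le hi1 hi2)
          (τ.natAbs_entry_pos hl1 hl2) (τ.natAbs_entry_le hl1 hl2) (by omega)
        rw [← hi, ← hl, τ.natAbs_entry_injective hi1 hi2 hl1 hl2 e]
      · exact absurd (by omega) (hl _ (τ.natAbs_entry_pos hi1 hi2) (τ.natAbs_entry_le hi1 hi2))
      · exact absurd (by omega) (hi _ (τ.natAbs_entry_pos hl1 hl2) (τ.natAbs_entry_le hl1 hl2))
      · omega)
  refine ⟨σ, fun i h1 h2 => ?_, fun j h1 h2 h => ?_⟩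
  · rw [hσ _ (hp.pos i h1 h2) (hp.le i h1 h2), hf1 _ i h1 h2 rfl]
  · rw [hσ j h1 h2, hf2 j h]

theorem exists_deflation {p : ℕ → ℕ} (hp : IsIncreasing m n p) (σ : SignedPerm n)
    (hfix : ∀ j : ℕ, 1 ≤ j → j ≤ n → (∀ i, 1 ≤ i → i ≤ m → p i ≠ j) → σ.entry j = j) :
    ∃ τ : SignedPerm m, IsInflation p τ σ := by
  have hg : ∀ i, ∃ k, 1 ≤ i → i ≤ m → 1 ≤ k ∧ k ≤ m ∧ p k = (σ.entry (p i)).natAbs := by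
    intro i
    -- If `|σ(p i)|` were outside the image of `p`, it would be a fixed point with the same absolute
    -- value of its entry as `p i`, hence equal to `p i`. The instance at 0 serves only to extract
    -- the bounds on `i`.
    by_contra! hcon
    have h1 := (hcon 0).1
    have h2 := (hcon 0).2.1
    have a1 := σ.natAbs_entry_pos (hp.pos i h1 h2) (hp.le i h1 h2)
    have a2 := σ.natAbs_entry_le (hp.pos i h1 h2) (hp.le i h1 h2)
    have hne : ∀ k, 1 ≤ k → k ≤ m → p k ≠ (σ.entry (p i)).natAbs :=
      fun k hk1 hk2 => (hcon k).2.2 hk1 hk2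
    have e := hfix _ a1 a2 hne
    have := σ.natAbs_entry_injective a1 a2 (hp.pos i h1 h2) (hp.le i h1 h2)
      (by rw [e, Int.natAbs_natCast])
    exact hne i h1 h2 this.symm
  choose g hg using hg
  have hs : ∀ i, 1 ≤ i → i ≤ m → σ.entry (p i) ≠ 0 := fun i h1 h2 => by
    have := σ.natAbs_entry_pos (hp.pos i h1 h2) (hp.le i h1 h2)
    omega
  have habs : ∀ i, 1 ≤ i → i ≤ m → ((σ.entry (p i)).sign * (g i : ℤ)).natAbs = g i :=
    fun i h1 h2 => by
      rw [Int.natAbs_mul, Int.natAbs_sign_of_ne_zero (hs i h1 h2), one_mul, Int.natAbs_natCast]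
  obtain ⟨τ, hτ⟩ := exists_entry_eq (n := m) (fun i => (σ.entry (p i)).sign * (g i : ℤ))
    (fun i h1 h2 => by
      rw [habs i h1 h2]
      exact ⟨(hg i h1 h2).1, (hg i h1 h2).2.1⟩)
    (fun i j hi1 hi2 hj1 hj2 h => by
      rw [habs i hi1 hi2, habs j hj1 hj2] at h
      refine hp.injective hi1 hi2 hj1 hj2 ?_
      refine σ.natAbs_entry_injective (hp.pos i hi1 hi2) (hp.le i hi1 hi2) (hp.pos j hj1 hj2)
        (hp.le j hj1 hj2) ?_
      rw [← (hg i hi1 hi2).2.2, ← (hg j hj1 hj2).2.2, h])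
  refine ⟨τ, fun i h1 h2 => ?_, hfix⟩
  rw [hτ i h1 h2, oddExt, habs i h1 h2, (hg i h1 h2).2.2, Int.sign_mul, Int.sign_sign,
    Int.sign_eq_one_of_pos (a := (g i : ℤ)) (by have := (hg i h1 h2).1; omega), mul_one,
    Int.sign_mul_natAbs]

/-! ### Block systems -/

/-- Disjoint consecutive blocks with endpoints `lo i ≤ hi i` inside `{1, …, n}`. -/
structure IsBlockSystem (m n : ℕ) (lo hi : ℕ → ℕ) : Prop where
  pos : ∀ i, 1 ≤ i → i ≤ m → 1 ≤ lo i
  le : ∀ i, 1 ≤ i → i ≤ m → hi i ≤ n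
  lo_le_hi : ∀ i, 1 ≤ i → i ≤ m → lo i ≤ hi i
  lt : ∀ i j, 1 ≤ i → i < j → j ≤ m → hi i < lo j

variable {lo hi p : ℕ → ℕ}

theorem IsBlockSystem.isIncreasing (hb : IsBlockSystem m n lo hi)
    (hp : ∀ i, 1 ≤ i → i ≤ m → p i = lo i ∨ p i = hi i) : IsIncreasing m n p := by
  refine ⟨fun i h1 h2 => ?_, fun i h1 h2 => ?_, fun i j h1 h2 h3 => ?_⟩
  · have := hb.pos i h1 h2
    have := hb.lo_le_hi i h1 h2
    rcases hp i h1 h2 with h | h <;> omega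
  · have := hb.le i h1 h2
    have := hb.lo_le_hi i h1 h2
    rcases hp i h1 h2 with h | h <;> omega
  · have := hb.lt i j h1 h2 h3
    have := hb.lo_le_hi i h1 (by omega)
    have := hb.lo_le_hi j (by omega) h3
    rcases hp i h1 (by omega) with h | h <;> rcases hp j (by omega) h3 with h' | h' <;> omega

/-- Every block has precisely one point that is not fixed: its lower end if this is an excedance,
and its upper end otherwise. All points that are not block ends are fixed. -/
structure IsBlockwise (m : ℕ) (lo hi : ℕ → ℕ) (σ : SignedPerm n) : Prop where
  fixed : ∀ j : ℕ, 1 ≤ j → j ≤ n → (∀ i, 1 ≤ i → i ≤ m → lo i ≠ j ∧ hi i ≠ j) → σ.entry j = j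
  block : ∀ i, 1 ≤ i → i ≤ m →
    ((lo i : ℤ) < σ.entry (lo i) ∧ (lo i ≠ hi i → σ.entry (hi i) = hi i)) ∨
    (σ.entry (hi i) < hi i ∧ (lo i ≠ hi i → σ.entry (lo i) = lo i))

/-- The positions at which the entries of `τ` are placed in the blocks. -/
def blockPos (lo hi : ℕ → ℕ) (τ : SignedPerm m) (i : ℕ) : ℕ :=
  if (i : ℤ) < τ.entry i then lo i else hi i

theorem blockPos_eq_or (lo hi : ℕ → ℕ) (τ : SignedPerm m) (i : ℕ) :
    blockPos lo hi τ i = lo i ∨ blockPos lo hi τ i = hi i := by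
  rw [blockPos]; split_ifs <;> simp

theorem IsBlockSystem.isIncreasing_blockPos (hb : IsBlockSystem m n lo hi) (τ : SignedPerm m) :
    IsIncreasing m n (blockPos lo hi τ) :=
  hb.isIncreasing fun i _ _ => blockPos_eq_or lo hi τ i

theorem IsInflation.isBlockwise (hb : IsBlockSystem m n lo hi) {τ : SignedPerm m}
    {σ : SignedPerm n} (hτ : τ.IsDerangement) (h : IsInflation (blockPos lo hi τ) τ σ) :
    IsBlockwise m lo hi σ := by
  have hp := hb.isIncreasing_blockPos τ
  refine ⟨fun j h1 h2 hj => h.entry_of_ne j h1 h2 fun i hi1 hi2 => ?_, fun i h1 h2 => ?_⟩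
  · rcases blockPos_eq_or lo hi τ i with e | e <;> rw [e]
    exacts [(hj i hi1 hi2).1, (hj i hi1 hi2).2]
  · have hne : ∀ x, lo i ≤ x → x ≤ hi i → x ≠ blockPos lo hi τ i →
        ∀ k, 1 ≤ k → k ≤ m → blockPos lo hi τ k ≠ x := by
      intro x hx1 hx2 hx k hk1 hk2 hk
      have := hb.lo_le_hi k hk1 hk2
      have h3 : lo k ≤ blockPos lo hi τ k ∧ blockPos lo hi τ k ≤ hi k := by
        rcases blockPos_eq_or lo hi τ k with e | e <;> omega
      rcases lt_trichotomy i k with hik | hik | hik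
      · have := hb.lt i k h1 hik hk2; omega
      · subst hik; exact hx hk.symm
      · have := hb.lt k i hk1 hik h2; omega
    have l1 := hb.pos i h1 h2
    have l2 := hb.le i h1 h2
    have l3 := hb.lo_le_hi i h1 h2
    by_cases hlt : (i : ℤ) < τ.entry i
    · have e : blockPos lo hi τ i = lo i := if_pos hlt
      have h' := (h.lt_entry_iff hp h1 h2).mpr hlt
      rw [e] at h'
      exact Or.inl ⟨h', fun hl => h.entry_of_ne _ (by omega) l2 (hne _ l3 le_rfl (by omega))⟩
    · have e : blockPos lo hi τ i = hi i := if_neg hlt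
      have hlt' : τ.entry i < i := lt_of_le_of_ne (not_lt.mp hlt) (hτ i h1 h2)
      have h' := (h.entry_lt_self_iff hp h1 h2).mpr hlt'
      rw [e] at h'
      exact Or.inr ⟨h', fun hl => h.entry_of_ne _ l1 (by omega) (hne _ le_rfl l3 (by omega))⟩

theorem IsBlockwise.exists_isInflation (hb : IsBlockSystem m n lo hi) {σ : SignedPerm n}
    (hσ : IsBlockwise m lo hi σ) :
    ∃ τ : SignedPerm m, τ.IsDerangement ∧ IsInflation (blockPos lo hi τ) τ σ := by
  classical
  -- The nonfixed end of each block, read off from `σ` since `τ` is not yet available; it agrees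
  -- with `blockPos` once excedances have been transferred to `τ`.
  let p : ℕ → ℕ := fun i => if (lo i : ℤ) < σ.entry (lo i) then lo i else hi i
  have hp1 : ∀ i, (lo i : ℤ) < σ.entry (lo i) → p i = lo i := fun i h => if_pos h
  have hp2 : ∀ i, ¬ (lo i : ℤ) < σ.entry (lo i) → p i = hi i := fun i h => if_neg h
  have hp : IsIncreasing m n p := hb.isIncreasing fun i _ _ => by
    by_cases h : (lo i : ℤ) < σ.entry (lo i)
    exacts [Or.inl (hp1 i h), Or.inr (hp2 i h)]
  have hblock : ∀ i, 1 ≤ i → i ≤ m →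
      (p i = lo i ∧ (lo i : ℤ) < σ.entry (lo i) ∧ (lo i ≠ hi i → σ.entry (hi i) = hi i)) ∨
      (p i = hi i ∧ σ.entry (hi i) < hi i ∧ (lo i ≠ hi i → σ.entry (lo i) = lo i)) := by
    intro i h1 h2
    by_cases h : (lo i : ℤ) < σ.entry (lo i)
    · refine Or.inl ⟨hp1 i h, h, ?_⟩
      rcases hσ.block i h1 h2 with h' | h'
      · exact h'.2
      · intro hl
        have := h'.2 hl
        omega
    · refine Or.inr ⟨hp2 i h, ?_⟩
      rcases hσ.block i h1 h2 with h' | h'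
      · exact absurd h'.1 h
      · exact h'
  obtain ⟨τ, hτ⟩ := exists_deflation hp σ fun j h1 h2 hj => by
    by_cases hex : ∃ i, 1 ≤ i ∧ i ≤ m ∧ (lo i = j ∨ hi i = j)
    · obtain ⟨i, hi1, hi2, hij⟩ := hex
      have := hj i hi1 hi2
      rcases hblock i hi1 hi2 with ⟨e, -, h⟩ | ⟨e, -, h⟩
      · have e' : hi i = j := by omega
        rw [← e']
        exact h (by omega)
      · have e' : lo i = j := by omega
        rw [← e']
        exact h (by omega)
    · refine hσ.fixed j h1 h2 fun i hi1 hi2 => ⟨fun h => ?_, fun h => ?_⟩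
      exacts [hex ⟨i, hi1, hi2, Or.inl h⟩, hex ⟨i, hi1, hi2, Or.inr h⟩]
  have hlt : ∀ i, 1 ≤ i → i ≤ m → (p i = lo i ∧ (i : ℤ) < τ.entry i) ∨
      (p i = hi i ∧ τ.entry i < i) := by
    intro i h1 h2
    rcases hblock i h1 h2 with ⟨e, h, -⟩ | ⟨e, h, -⟩
    · exact Or.inl ⟨e, (hτ.lt_entry_iff hp h1 h2).mp (by rw [e]; exact h)⟩
    · exact Or.inr ⟨e, (hτ.entry_lt_self_iff hp h1 h2).mp (by rw [e]; exact h)⟩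
  refine ⟨τ, fun i h1 h2 => ?_, hτ.congr fun i h1 h2 => ?_⟩
  · rcases hlt i h1 h2 with h | h <;> omega
  · rw [blockPos]
    rcases hlt i h1 h2 with h | h
    · rw [if_pos h.2, h.1]
    · rw [if_neg (by omega), h.1]

/-- If the two choices differed in some block, the end chosen by `τ` would be a fixed point inserted
by `τ'`, whereas a derangement puts a nonfixed point there. -/
theorem blockPos_eq_of_isInflation (hb : IsBlockSystem m n lo hi) {τ τ' : SignedPerm m}
    {σ : SignedPerm n} (hτ : τ.IsDerangement) (h : IsInflation (blockPos lo hi τ) τ σ)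
    (h' : IsInflation (blockPos lo hi τ') τ' σ) {i : ℕ} (h1 : 1 ≤ i) (h2 : i ≤ m) :
    blockPos lo hi τ i = blockPos lo hi τ' i := by
  have hp := hb.isIncreasing_blockPos τ
  by_contra hne
  have hfix : σ.entry (blockPos lo hi τ i) = (blockPos lo hi τ i : ℕ) := by
    refine h'.entry_of_ne _ (hp.pos i h1 h2) (hp.le i h1 h2) fun k hk1 hk2 hk => ?_
    have := hb.lo_le_hi i h1 h2
    have := hb.lo_le_hi k hk1 hk2
    have e1 := blockPos_eq_or lo hi τ i
    have e2 := blockPos_eq_or lo hi τ' k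
    rcases lt_trichotomy i k with hik | hik | hik
    · have := hb.lt i k h1 hik hk2; omega
    · subst hik; exact hne hk.symm
    · have := hb.lt k i hk1 hik h2; omega
  have a := h.lt_entry_iff hp h1 h2
  have b := h.entry_lt_self_iff hp h1 h2
  have := hτ i h1 h2
  omega

/-- Inserting fixed points blockwise identifies derangements with blockwise signed permutations. -/
theorem card_derangement_eq_card_blockwise (hb : IsBlockSystem m n lo hi)
    (P : SignedPerm m → Prop) (Q : SignedPerm n → Prop)
    (hQ : ∀ σ, Q σ → IsBlockwise m lo hi σ)
    (hPQ : ∀ τ σ, τ.IsDerangement → IsInflation (blockPos lo hi τ) τ σ →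
      IsBlockwise m lo hi σ → (P τ ↔ Q σ)) :
    Nat.card {τ : SignedPerm m // τ.IsDerangement ∧ P τ} = Nat.card {σ : SignedPerm n // Q σ} := by
  choose F hF using fun τ : SignedPerm m =>
    SignedPerm.exists_isInflation (hb.isIncreasing_blockPos τ) τ
  refine Nat.card_eq_of_bijective
    (fun τ => (⟨F τ.1, (hPQ _ _ τ.2.1 (hF τ.1) ((hF τ.1).isBlockwise hb τ.2.1)).mp τ.2.2⟩ :
      {σ : SignedPerm n // Q σ})) ⟨fun τ τ' h => ?_, fun σ => ?_⟩
  · have h' : F τ.1 = F τ'.1 := congrArg Subtype.val h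
    have i1 := hF τ.1
    have i2 := hF τ'.1
    rw [← h'] at i2
    refine Subtype.ext ((i1.unique_left (hb.isIncreasing_blockPos τ.1)) (i2.congr ?_))
    exact fun i hi1 hi2 => (blockPos_eq_of_isInflation hb τ.2.1 i1 i2 hi1 hi2).symm
  · have hσ := hQ σ.1 σ.2
    obtain ⟨τ, hτ, h⟩ := hσ.exists_isInflation hb
    refine ⟨⟨τ, hτ, (hPQ τ σ.1 hτ h hσ).mpr σ.2⟩, Subtype.ext ?_⟩
    exact (hF τ).unique_right h

/-! ### Counting fixed points -/

theorem card_nonfixed_add_numFixed (σ : SignedPerm n) :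
    ((Finset.Icc 1 n).filter fun i : ℕ => σ.entry i ≠ i).card + σ.numFixed = n := by
  have := Finset.card_filter_add_card_filter_not (s := Finset.Icc 1 n)
    (fun i : ℕ => σ.entry i = i)
  rw [Nat.card_Icc] at this
  rw [numFixed]
  simp only [ne_eq]
  omega

/-- The nonfixed points are exactly the image of `p`: since `τ` is a derangement, each of its
entries lies strictly above or below its position, and inflation keeps this. -/
theorem numFixed_of_isInflation (hp : IsIncreasing m n p) {τ : SignedPerm m} {σ : SignedPerm n}
    (hτ : τ.IsDerangement) (h : IsInflation p τ σ) : m + σ.numFixed = n := by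
  have e : ((Finset.Icc 1 n).filter fun i : ℕ => σ.entry i ≠ i) = (Finset.Icc 1 m).image p := by
    ext j
    simp only [Finset.mem_filter, Finset.mem_Icc, Finset.mem_image]
    constructor
    · rintro ⟨⟨h1, h2⟩, h3⟩
      by_contra hj
      exact h3 (h.entry_of_ne j h1 h2 fun i hi1 hi2 hi => hj ⟨i, ⟨hi1, hi2⟩, hi⟩)
    · rintro ⟨i, ⟨h1, h2⟩, rfl⟩
      refine ⟨⟨hp.pos i h1 h2, hp.le i h1 h2⟩, ?_⟩
      have a := h.lt_entry_iff hp h1 h2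
      have b := h.entry_lt_self_iff hp h1 h2
      have := hτ i h1 h2
      omega
  have hc : ((Finset.Icc 1 m).image p).card = m := by
    rw [Finset.card_image_of_injOn, Nat.card_Icc]
    · omega
    · intro i hi j hj hij
      rw [Finset.coe_Icc, Set.mem_Icc] at hi hj
      exact hp.injective hi.1 hi.2 hj.1 hj.2 hij
  have := σ.card_nonfixed_add_numFixed
  rw [e, hc] at this
  exact this

/-- If every block contains a point that is not fixed and there are only `m` points that are not
fixed, then one can choose one such point in each block and all others are fixed. -/
theorem exists_nonfixed_points (hb : IsBlockSystem m n lo hi) {σ : SignedPerm n}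
    (hcard : m + σ.numFixed = n)
    (hne : ∀ i, 1 ≤ i → i ≤ m → σ.entry (lo i) ≠ lo i ∨ σ.entry (hi i) ≠ hi i) :
    ∃ p : ℕ → ℕ, IsIncreasing m n p ∧
      (∀ i, 1 ≤ i → i ≤ m → (p i = lo i ∨ p i = hi i) ∧ σ.entry (p i) ≠ p i) ∧
      ∀ j : ℕ, 1 ≤ j → j ≤ n → (∀ i, 1 ≤ i → i ≤ m → p i ≠ j) → σ.entry j = j := by
  have hex : ∀ i, ∃ x, 1 ≤ i → i ≤ m → (x = lo i ∨ x = hi i) ∧ σ.entry x ≠ x := by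
    intro i
    by_cases h : 1 ≤ i ∧ i ≤ m
    · rcases hne i h.1 h.2 with h' | h'
      exacts [⟨lo i, fun _ _ => ⟨Or.inl rfl, h'⟩⟩, ⟨hi i, fun _ _ => ⟨Or.inr rfl, h'⟩⟩]
    · exact ⟨0, fun h1 h2 => absurd ⟨h1, h2⟩ h⟩
  choose p hp using hex
  have hinc : IsIncreasing m n p := hb.isIncreasing fun i h1 h2 => (hp i h1 h2).1
  refine ⟨p, hinc, hp, fun j h1 h2 hj => ?_⟩
  have hc : ((Finset.Icc 1 m).image p).card = m := by
    rw [Finset.card_image_of_injOn, Nat.card_Icc]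
    · omega
    · intro i hi j hj hij
      rw [Finset.coe_Icc, Set.mem_Icc] at hi hj
      exact hinc.injective hi.1 hi.2 hj.1 hj.2 hij
  have hsub : (Finset.Icc 1 m).image p ⊆ (Finset.Icc 1 n).filter fun i : ℕ => σ.entry i ≠ i := by
    intro x hx
    simp only [Finset.mem_filter, Finset.mem_Icc, Finset.mem_image] at hx ⊢
    obtain ⟨i, ⟨h1, h2⟩, rfl⟩ := hx
    exact ⟨⟨hinc.pos i h1 h2, hinc.le i h1 h2⟩, (hp i h1 h2).2⟩
  have hcard' := σ.card_nonfixed_add_numFixed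
  have heq := Finset.eq_of_subset_of_card_le hsub (by omega)
  by_contra hcon
  have : j ∈ (Finset.Icc 1 m).image p := by
    rw [heq, Finset.mem_filter, Finset.mem_Icc]
    exact ⟨⟨h1, h2⟩, hcon⟩
  obtain ⟨i, hi', hij⟩ := Finset.mem_image.mp this
  rw [Finset.mem_Icc] at hi'
  exact hj i hi'.1 hi'.2 hij

/-! ### Alternating signed permutations -/

/-- The signs of `σ_{i+1} - σ_i` alternate, with descents at the `i` such that `i + c` is odd. -/
def Alternating (c : ℕ) (σ : SignedPerm n) : Prop :=
  ∀ i : ℕ, 1 ≤ i → i + 1 ≤ n →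
    (Odd (i + c) → σ.entry (i + 1) < σ.entry i) ∧ (Even (i + c) → σ.entry i < σ.entry (i + 1))

/-- The first element of block `i` when the first `r` points are blocks of their own, followed
by `s` points outside all blocks and then by blocks of two points. -/
def blockLo (r s i : ℕ) : ℕ := if i ≤ r then i else 2 * i + s - (r + 1)

/-- The last element of block `i`, see `blockLo`. -/
def blockHi (r s i : ℕ) : ℕ := if i ≤ r then i else 2 * i + s - r

theorem blockLo_of_le {r i : ℕ} (s : ℕ) (h : i ≤ r) : blockLo r s i = i := if_pos h

theorem blockHi_of_le {r i : ℕ} (s : ℕ) (h : i ≤ r) : blockHi r s i = i := if_pos h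

theorem blockLo_of_lt {r i : ℕ} (s : ℕ) (h : r < i) : blockLo r s i = 2 * i + s - (r + 1) :=
  if_neg (by omega)

theorem blockHi_of_lt {r i : ℕ} (s : ℕ) (h : r < i) : blockHi r s i = 2 * i + s - r :=
  if_neg (by omega)

theorem isBlockSystem {r s e : ℕ} (hn : n + r = 2 * m + s + e) (hrm : r ≤ m) :
    IsBlockSystem m n (blockLo r s) (blockHi r s) := by
  refine ⟨fun i h1 h2 => ?_, fun i h1 h2 => ?_, fun i h1 h2 => ?_, fun i j h1 h2 h3 => ?_⟩ <;>
  simp only [blockLo, blockHi] <;> split_ifs <;> omega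

variable {r s e : ℕ}

/-- The `m` blocks use up all `m` nonfixed points. In a pair, the descent compares the one nonfixed
entry with the fixed other end, which decides on which side of its position it lies. -/
theorem Alternating.isBlockwise (hn : n + r = 2 * m + s + e) (hrm : r ≤ m) {σ : SignedPerm n}
    (halt : σ.Alternating (r + s)) (hneg : ∀ i : ℕ, 1 ≤ i → i ≤ r → σ.entry i < 0)
    (hcard : m + σ.numFixed = n) : IsBlockwise m (blockLo r s) (blockHi r s) σ := by
  have hb := isBlockSystem hn hrm
  have hdesc : ∀ i, r < i → i ≤ m → σ.entry (blockHi r s i) < σ.entry (blockLo r s i) := by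
    intro i h1 h2
    have e : blockHi r s i = blockLo r s i + 1 := by
      rw [blockHi_of_lt s h1, blockLo_of_lt s h1]; omega
    have := hb.le i (by omega) h2
    have := (halt (blockLo r s i) (hb.pos i (by omega) h2) (by omega)).1
      (by rw [blockLo_of_lt s h1]; exact ⟨i + s - 1, by omega⟩)
    rw [e]
    exact_mod_cast this
  have hlt : ∀ i, r < i → blockLo r s i < blockHi r s i := fun i h => by
    rw [blockHi_of_lt s h, blockLo_of_lt s h]; omega
  obtain ⟨p, hinc, hp, hfix⟩ := exists_nonfixed_points hb hcard fun i h1 h2 => by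
    rcases le_or_gt i r with h | h
    · have := hneg i h1 h
      rw [blockLo_of_le s h]
      exact Or.inl (by omega)
    · have := hdesc i h h2
      have := hlt i h
      omega
  refine ⟨fun j h1 h2 h => hfix j h1 h2 fun i hi1 hi2 hi => ?_, fun i h1 h2 => ?_⟩
  · have := h i hi1 hi2
    have := (hp i hi1 hi2).1
    omega
  · rcases le_or_gt i r with h | h
    · have := hneg i h1 h
      rw [blockLo_of_le s h, blockHi_of_le s h]
      exact Or.inr ⟨by omega, fun h => absurd rfl h⟩
    · have hd := hdesc i h h2
      have hl := hlt i h
      have l1 := hb.pos i h1 h2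
      have l2 := hb.le i h1 h2
      have hother : ∀ x, blockLo r s i ≤ x → x ≤ blockHi r s i → p i ≠ x → σ.entry x = x := by
        intro x hx1 hx2 hx
        refine hfix x (by omega) (by omega) fun k hk1 hk2 hk => ?_
        have := hb.lo_le_hi k hk1 hk2
        have := (hp k hk1 hk2).1
        rcases lt_trichotomy i k with hik | hik | hik
        · have := hb.lt i k h1 hik hk2; omega
        · subst hik; exact hx hk
        · have := hb.lt k i hk1 hik h2; omega
      rcases (hp i h1 h2).1 with e | e
      · have := hother _ hl.le le_rfl (by omega)
        exact Or.inl ⟨by omega, fun _ => this⟩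
      · have := hother _ le_rfl hl.le (by omega)
        exact Or.inr ⟨by omega, fun _ => this⟩

/-- One end is fixed and the other entry points away from it. For adjacent ends, no integer lies
strictly between them and injectivity excludes equal entries, so a descent results. -/
theorem IsBlockwise.entry_le_and_le_entry {lo hi : ℕ → ℕ} (hb : IsBlockSystem m n lo hi)
    {σ : SignedPerm n} (hσ : IsBlockwise m lo hi σ) {i : ℕ} (h1 : 1 ≤ i) (h2 : i ≤ m)
    (hlt : lo i < hi i) :
    σ.entry (hi i) ≤ hi i ∧ (lo i : ℤ) ≤ σ.entry (lo i) ∧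
      (lo i + 1 = hi i → σ.entry (hi i) < σ.entry (lo i)) := by
  have l1 := hb.pos i h1 h2
  have l2 := hb.le i h1 h2
  have hne : σ.entry (lo i) ≠ σ.entry (hi i) := fun h => by
    have := σ.natAbs_entry_injective l1 (by omega) (by omega) l2 (congrArg Int.natAbs h)
    omega
  rcases hσ.block i h1 h2 with ⟨h, h'⟩ | ⟨h, h'⟩
  · have := h' hlt.ne
    omega
  · have := h' hlt.ne
    omega

theorem IsBlockwise.alternating (hn : n + r = 2 * m + s + e) (hrm : r ≤ m)
    (hrs : r ≤ 2 ∧ s = 0 ∨ r = 0 ∧ s = 1) (he : e ≤ 1) {σ : SignedPerm n}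
    (hσ : IsBlockwise m (blockLo r s) (blockHi r s) σ)
    (hneg : ∀ i : ℕ, 1 ≤ i → i ≤ r → σ.entry i < 0)
    (hdesc : ∀ i : ℕ, 1 ≤ i → i + 1 ≤ r → σ.entry (i + 1 : ℕ) < σ.entry i) :
    σ.Alternating (r + s) := by
  have hb := isBlockSystem hn hrm
  have hblock : ∀ i, r < i → i ≤ m → _ := fun i h1 h2 =>
    hσ.entry_le_and_le_entry hb (i := i) (by omega) h2
      (by rw [blockHi_of_lt s h1, blockLo_of_lt s h1]; omega)
  have hfirst : s = 1 → 1 ≤ n → σ.entry (1 : ℕ) = (1 : ℕ) := fun hs h =>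
    hσ.fixed 1 le_rfl h fun i h1 h2 => by
      rw [blockHi_of_lt s (by omega), blockLo_of_lt s (by omega)]
      omega
  have hlast : e = 1 → 1 ≤ n → σ.entry n = n := fun he h =>
    hσ.fixed n h le_rfl fun i h1 h2 => by
      simp only [blockLo, blockHi]
      split_ifs <;> omega
  intro j h1 h2
  rw [show (j : ℤ) + 1 = (j + 1 : ℕ) by push_cast; rfl]
  refine ⟨fun ⟨k, hk⟩ => ?_, fun ⟨k, hk⟩ => ?_⟩
  · by_cases hj : j + 1 ≤ r
    · exact hdesc j h1 hj
    · have hr : r < k + 1 - s := by omega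
      have a := hblock _ hr (by omega)
      rw [blockHi_of_lt s hr, blockLo_of_lt s hr] at a
      have e1 : 2 * (k + 1 - s) + s - r = j + 1 := by omega
      have e2 : 2 * (k + 1 - s) + s - (r + 1) = j := by omega
      rw [e1, e2] at a
      exact a.2.2 rfl
  -- An ascent joins consecutive blocks or unblocked points; it follows from `σ_j ≤ j` and `j + 1 ≤
  -- σ_{j+1}`.
  · have low : σ.entry j ≤ j := by
      by_cases hj : j ≤ r
      · have := hneg j h1 hj
        omega
      by_cases hj' : j ≤ s
      · have := hfirst (by omega) (by omega)
        rw [show j = 1 by omega, this]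
      · have hr : r < k - s := by omega
        have a := hblock _ hr (by omega)
        rw [blockHi_of_lt s hr, show 2 * (k - s) + s - r = j by omega] at a
        exact a.1
    have high : ((j + 1 : ℕ) : ℤ) ≤ σ.entry (j + 1 : ℕ) := by
      by_cases hj : j + 1 = n ∧ e = 1
      · rw [hj.1, hlast hj.2 (by omega)]
      · have hr : r < k + 1 - s := by omega
        have a := hblock _ hr (by omega)
        rw [blockLo_of_lt s hr, show 2 * (k + 1 - s) + s - (r + 1) = j + 1 by omega] at a
        exact a.2.1
    omega

/-- The alternating signed permutations whose first `r` entries are negative and which have the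
maximal number of fixed points are in bijection with derangements. -/
theorem card_derangement_eq_card_alternating (hn : n + r = 2 * m + s + e) (hrm : r ≤ m)
    (hrs : r ≤ 2 ∧ s = 0 ∨ r = 0 ∧ s = 1) (he : e ≤ 1) :
    Nat.card {τ : SignedPerm m // τ.IsDerangement ∧ (∀ i : ℕ, 1 ≤ i → i ≤ r → τ.entry i < 0) ∧
      ∀ i : ℕ, 1 ≤ i → i + 1 ≤ r → τ.entry (i + 1 : ℕ) < τ.entry i} =
    Nat.card {σ : SignedPerm n // σ.Alternating (r + s) ∧
      (∀ i : ℕ, 1 ≤ i → i ≤ r → σ.entry i < 0) ∧ m + σ.numFixed = n} := by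
  have hb := isBlockSystem hn hrm
  refine card_derangement_eq_card_blockwise hb _ _
    (fun σ h => h.1.isBlockwise hn hrm h.2.1 h.2.2) fun τ σ hτ h hσ => ?_
  have hp := hb.isIncreasing_blockPos τ
  have hpos : ∀ i, i ≤ r → blockPos (blockLo r s) (blockHi r s) τ i = i := fun i hi => by
    have := blockPos_eq_or (blockLo r s) (blockHi r s) τ i
    rwa [blockLo_of_le s hi, blockHi_of_le s hi, or_self] at this
  have hneg : ∀ i : ℕ, 1 ≤ i → i ≤ r → (σ.entry i < 0 ↔ τ.entry i < 0) := fun i h1 h2 => by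
    have := h.entry_neg_iff hp h1 (h2.trans hrm)
    rwa [hpos i h2] at this
  have hlt : ∀ i : ℕ, 1 ≤ i → i + 1 ≤ r →
      (σ.entry (i + 1 : ℕ) < σ.entry i ↔ τ.entry (i + 1 : ℕ) < τ.entry i) := fun i h1 h2 => by
    have := h.entry_lt_iff hp (i := i + 1) (j := i) (by omega) (by omega) h1 (by omega)
    rwa [hpos _ h2, hpos i (by omega)] at this
  constructor
  · rintro ⟨h1, h2⟩
    have h1' : ∀ i : ℕ, 1 ≤ i → i ≤ r → σ.entry i < 0 :=
      fun i hi1 hi2 => (hneg i hi1 hi2).mpr (h1 i hi1 hi2)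
    exact ⟨hσ.alternating hn hrm hrs he h1' fun i hi1 hi2 => (hlt i hi1 hi2).mpr (h2 i hi1 hi2),
      h1', numFixed_of_isInflation hp hτ h⟩
  · rintro ⟨h1, h2, -⟩
    refine ⟨fun i hi1 hi2 => (hneg i hi1 hi2).mp (h2 i hi1 hi2), fun i hi1 hi2 => ?_⟩
    refine (hlt i hi1 hi2).mp ?_
    -- The bounds leave only `i = 1`, `r = 2`, `s = 0`, where `i + (r + s) = 3` is odd.
    have := (h1 i hi1 (by omega)).1 ⟨(i + r + s) / 2, by omega⟩
    exact_mod_cast this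

/-! ### The four alternating types -/

theorem alternating_iff_downUp {c : ℕ} (hc : Even c) (σ : SignedPerm n) :
    σ.Alternating c ↔ σ.DownUp := by
  simp only [Alternating, DownUp, Nat.odd_add, Nat.even_add, hc, iff_true]

theorem alternating_iff_upDown {c : ℕ} (hc : Odd c) (σ : SignedPerm n) :
    σ.Alternating c ↔ σ.UpDown := by
  have hc' : ¬ Even c := Nat.not_even_iff_odd.mpr hc
  simp only [Alternating, UpDown, Nat.odd_add, Nat.even_add, hc', iff_false,
    Nat.not_even_iff_odd, Nat.not_odd_iff_even]
  exact forall_congr' fun i => forall_congr' fun _ => forall_congr' fun _ => and_comm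

/-- Position 1 is either the lower end of a pair, where the entry is at least its position, or
outside all blocks and hence fixed. Positivity is therefore automatic in the two `+` types. -/
theorem Alternating.entry_one_pos (hn : n = 2 * m + s + e) (hs : s ≤ 1) (h1 : 1 ≤ n)
    {σ : SignedPerm n} (halt : σ.Alternating (0 + s)) (hcard : m + σ.numFixed = n) :
    0 < σ.entry 1 := by
  have hσ := halt.isBlockwise (r := 0) (e := e) (m := m) (by omega) (by omega)
    (fun i _ _ => by omega) hcard
  by_cases hm : 1 ≤ m ∧ s = 0
  · have hb : IsBlockSystem m n (blockLo 0 s) (blockHi 0 s) :=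
      isBlockSystem (r := 0) (e := e) (by omega) (by omega)
    have h := (hσ.entry_le_and_le_entry hb le_rfl hm.1
      (by rw [blockHi_of_lt s one_pos, blockLo_of_lt s one_pos]; omega)).2.1
    rw [blockLo_of_lt s one_pos, hm.2] at h
    exact lt_of_lt_of_le one_pos h
  · have h := hσ.fixed 1 le_rfl h1 fun i hi1 hi2 => by
      rw [blockHi_of_lt s hi1, blockLo_of_lt s hi1]
      omega
    rw [Nat.cast_one] at h
    omega

theorem dPosDU_eq (hn : n = 2 * m + e) (he : e ≤ 1) (h1 : 1 ≤ n) :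
    dPosDU ((n : ℤ) - m) n = derangementsB m := by
  have key := card_derangement_eq_card_alternating (n := n) (m := m) (r := 0) (s := 0) (e := e)
    (by omega) (by omega) (by omega) he
  refine (Nat.card_congr (Equiv.subtypeEquivRight fun σ => ?_)).trans
    (key.symm.trans (Nat.card_congr (Equiv.subtypeEquivRight fun τ => ?_)))
  · rw [IsPosDU, ← alternating_iff_downUp (c := 0 + 0) ⟨0, rfl⟩]
    constructor
    · rintro ⟨⟨-, h⟩, h'⟩
      exact ⟨h, fun i _ _ => by omega, by omega⟩
    · rintro ⟨h, -, h'⟩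
      exact ⟨⟨h.entry_one_pos (m := m) (e := e) hn (by omega) h1 h', h⟩, by omega⟩
  · exact ⟨fun h => h.1, fun h => ⟨h, fun i _ _ => by omega, fun i _ _ => by omega⟩⟩

theorem dPosUD_eq (hn : n = 2 * m + 1 + e) (he : e ≤ 1) :
    dPosUD ((n : ℤ) - m) n = derangementsB m := by
  have key := card_derangement_eq_card_alternating (n := n) (m := m) (r := 0) (s := 1) (e := e)
    (by omega) (by omega) (by omega) he
  refine (Nat.card_congr (Equiv.subtypeEquivRight fun σ => ?_)).trans
    (key.symm.trans (Nat.card_congr (Equiv.subtypeEquivRight fun τ => ?_)))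
  · rw [IsPosUD, ← alternating_iff_upDown (c := 0 + 1) ⟨0, rfl⟩]
    constructor
    · rintro ⟨⟨-, h⟩, h'⟩
      exact ⟨h, fun i _ _ => by omega, by omega⟩
    · rintro ⟨h, -, h'⟩
      exact ⟨⟨h.entry_one_pos (m := m) (e := e) hn le_rfl (by omega) h', h⟩, by omega⟩
  · exact ⟨fun h => h.1, fun h => ⟨h, fun i _ _ => by omega, fun i _ _ => by omega⟩⟩

theorem forall_neg_one_iff (σ : SignedPerm n) :
    (∀ i : ℕ, 1 ≤ i → i ≤ 1 → σ.entry i < 0) ↔ σ.entry 1 < 0 := by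
  refine ⟨fun h => ?_, fun h i h1 h2 => ?_⟩
  · exact_mod_cast h 1 le_rfl le_rfl
  · rw [show i = 1 by omega]
    exact_mod_cast h

theorem dNegUD_eq (hn : n + 1 = 2 * m + e) (he : e ≤ 1) (h1 : 1 ≤ n) :
    dNegUD ((n : ℤ) - m) n = derangementsNeg m := by
  have key := card_derangement_eq_card_alternating (n := n) (m := m) (r := 1) (s := 0) (e := e)
    (by omega) (by omega) (by omega) he
  refine (Nat.card_congr (Equiv.subtypeEquivRight fun σ => ?_)).trans
    (key.symm.trans (Nat.card_congr (Equiv.subtypeEquivRight fun τ => ?_)))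
  · rw [IsNegUD, ← alternating_iff_upDown (c := 1 + 0) ⟨0, rfl⟩, forall_neg_one_iff]
    constructor
    · rintro ⟨⟨h, h'⟩, h''⟩
      exact ⟨h', h, by omega⟩
    · rintro ⟨h', h, h''⟩
      exact ⟨⟨h, h'⟩, by omega⟩
  · rw [forall_neg_one_iff]
    exact ⟨fun h => ⟨h.1, h.2.1⟩, fun h => ⟨h.1, h.2, fun i _ _ => by omega⟩⟩

theorem dNegDU_eq (hn : n + 2 = 2 * m + e) (he : e ≤ 1) (h2 : 2 ≤ n) :
    dNegDU ((n : ℤ) - m) n = derangementsNegD m := by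
  have key := card_derangement_eq_card_alternating (n := n) (m := m) (r := 2) (s := 0) (e := e)
    (by omega) (by omega) (by omega) he
  refine (Nat.card_congr (Equiv.subtypeEquivRight fun σ => ?_)).trans
    (key.symm.trans (Nat.card_congr (Equiv.subtypeEquivRight fun τ => ?_)))
  · rw [IsNegDU, ← alternating_iff_downUp (c := 2 + 0) ⟨1, rfl⟩]
    constructor
    · rintro ⟨⟨h, h'⟩, h''⟩
      have hlt : σ.entry 2 < σ.entry 1 := (h' 1 le_rfl h2).1 ⟨1, rfl⟩
      refine ⟨h', fun i hi1 hi2 => ?_, by omega⟩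
      obtain rfl | rfl : i = 1 ∨ i = 2 := by omega
      exacts [h, hlt.trans h]
    · rintro ⟨h', h, h''⟩
      exact ⟨⟨h 1 le_rfl one_le_two, h'⟩, by omega⟩
  · constructor
    · rintro ⟨hτ, h, h'⟩
      exact ⟨hτ, h 1 le_rfl one_le_two, fun _ => h' 1 le_rfl le_rfl⟩
    · rintro ⟨hτ, h, h'⟩
      have hlt := h' (by omega)
      refine ⟨hτ, fun i hi1 hi2 => ?_, fun i hi1 hi2 => ?_⟩
      · obtain rfl | rfl : i = 1 ∨ i = 2 := by omega
        exacts [h, hlt.trans h]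
      · obtain rfl : i = 1 := by omega
        exact hlt

/-- Two initial singleton blocks do not fit into length 1. There all alternation conditions are
vacuous, so the count agrees with that of type `-UD`. -/
theorem dNegDU_zero_one : dNegDU 0 1 = derangementsNegD 1 := by
  have h := dNegUD_eq (n := 1) (m := 1) (e := 0) rfl zero_le_one le_rfl
  rw [Nat.cast_one, sub_self] at h
  refine (Nat.card_congr (Equiv.subtypeEquivRight fun σ => ?_)).trans
    (h.trans (Nat.card_congr (Equiv.subtypeEquivRight fun τ => ?_)))
  · have h1 : σ.DownUp := fun i _ _ => by omega
    have h2 : σ.UpDown := fun i _ _ => by omega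
    simp only [IsNegDU, IsNegUD, h1, h2]
  · simp

end SignedPerm

/-! ### Floors, ceilings and the parity of the length -/

theorem natFloor_eq_of_two_mul_eq {x : ℚ} {m e : ℕ} (he : e ≤ 1) (h : 2 * x = 2 * m + e) :
    ⌊x⌋₊ = m := by
  have he' : (e : ℚ) ≤ 1 := by exact_mod_cast he
  have he0 : (0 : ℚ) ≤ e := e.cast_nonneg
  have hm0 : (0 : ℚ) ≤ m := m.cast_nonneg
  rw [Nat.floor_eq_iff (by linarith)]
  constructor <;> linarith

theorem intCeil_eq_of_two_mul_eq {x : ℚ} {k : ℤ} {e : ℕ} (he : e ≤ 1) (h : 2 * x + e = 2 * k) :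
    ⌈x⌉ = k := by
  have he' : (e : ℚ) ≤ 1 := by exact_mod_cast he
  have he0 : (0 : ℚ) ≤ e := e.cast_nonneg
  rw [Int.ceil_eq_iff]
  constructor <;> linarith

theorem theorem2p4 (n : ℕ) (hn : 1 ≤ n) :
    dNegDU ⌈((n : ℚ) - 2) / 2⌉ n = derangementsNegD ⌊((n : ℚ) + 2) / 2⌋₊ ∧
    dNegUD ⌈((n : ℚ) - 1) / 2⌉ n = derangementsNeg ⌊((n : ℚ) + 1) / 2⌋₊ ∧
    dPosDU ⌈(n : ℚ) / 2⌉ n = derangementsB ⌊(n : ℚ) / 2⌋₊ ∧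
    dPosUD ⌈((n : ℚ) + 1) / 2⌉ n = derangementsB ⌊((n : ℚ) - 1) / 2⌋₊ := by
  -- The quotient `m` is the number of blocks and the remainder `e` the number of leftover last
  -- points; in each identity the ceiling then equals `n - m`.
  have split : ∀ a : ℕ, ∃ m e : ℕ, e ≤ 1 ∧ a = 2 * m + e := fun a =>
    ⟨a / 2, a % 2, by omega, by omega⟩
  refine ⟨?_, ?_, ?_, ?_⟩
  · obtain ⟨m, e, he, h⟩ := split (n + 2)
    have hq : (n : ℚ) + 2 = 2 * m + e := by exact_mod_cast h
    rw [natFloor_eq_of_two_mul_eq (m := m) he (by linarith),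
      intCeil_eq_of_two_mul_eq (k := (n : ℤ) - m) he (by push_cast; linarith)]
    rcases hn.eq_or_lt with rfl | hn
    · obtain rfl : m = 1 := by omega
      exact SignedPerm.dNegDU_zero_one
    · exact SignedPerm.dNegDU_eq h he hn
  · obtain ⟨m, e, he, h⟩ := split (n + 1)
    have hq : (n : ℚ) + 1 = 2 * m + e := by exact_mod_cast h
    rw [natFloor_eq_of_two_mul_eq (m := m) he (by linarith),
      intCeil_eq_of_two_mul_eq (k := (n : ℤ) - m) he (by push_cast; linarith)]
    exact SignedPerm.dNegUD_eq h he hn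
  · obtain ⟨m, e, he, h⟩ := split n
    have hq : (n : ℚ) = 2 * m + e := by exact_mod_cast h
    rw [natFloor_eq_of_two_mul_eq (m := m) he (by linarith),
      intCeil_eq_of_two_mul_eq (k := (n : ℤ) - m) he (by push_cast; linarith)]
    exact SignedPerm.dPosDU_eq h he hn
  · obtain ⟨m, e, he, h⟩ := split (n - 1)
    have h' : n = 2 * m + 1 + e := by omega
    have hq : (n : ℚ) = 2 * m + 1 + e := by exact_mod_cast h'
    rw [natFloor_eq_of_two_mul_eq (m := m) he (by linarith),
      intCeil_eq_of_two_mul_eq (k := (n : ℤ) - m) he (by push_cast; linarith)]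
    exact SignedPerm.dPosUD_eq h' he
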